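/- A double poset is a finite set $P$ with two partial orders $\leq_1,\leq_2$. Let $K$ be a field and let $\mathcal H_{\mathcal{DP}}$ be the $K$-vector space having the set of isomorphism classes of double posets as a basis (it underlies the Malvenuto–Reutenauer Hopf algebra of double posets). It carries the bilinear pairing defined on the basis by $\langle P,Q\rangle=|S(P,Q)|\cdot 1_K$, where $S(P,Q)$ is the set of pictures between $P$ and $Q$, i.e. of bijections $\sigma:P\to Q$ such that for all $i,j\in P$: $i\leq_1 j$ implies $\sigma(i)\leq_2\sigma(j)$, and $\sigma(i)\leq_1\sigma(j)$ implies $i\leq_2 j$. A plane poset is a double poset $(P,\leq_h,\leq_r)$ in which any two distinct elements are comparable for $\leq_h$ if and only if they are not comparable for $\leq_r$; it is a plane forest if the Hasse graph of $(P,\leq_h)$, oriented from the minimal elements (roots) upwards, is a rooted forest. A plane poset is seen as the special double poset $(P,\leq_h,\leq)$, where $x\leq y$ if and only if $x\leq_h y$ or $x\leq_r y$ (this is a total order). Let $\mathcal H_{\mathcal{SPF}}\subseteq\mathcal H_{\mathcal{DP}}$ be the subspace (in fact a Hopf subalgebra) spanned by the classes of plane forests seen as special double posets. Then, for every field $K$,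 the restriction of $\langle -,-\rangle$ to $\mathcal H_{\mathcal{SPF}}$ is nondegenerate: the only element of $\mathcal H_{\mathcal{SPF}}$ that is orthogonal to all of $\mathcal H_{\mathcal{SPF}}$ (on either side) is $0$. -/

import Mathlib

/-- A double poset: a finite set endowed with two partial orders `≤₁` and `≤₂`. -/
structure DoublePoset where
  /-- the underlying set -/
  carrier : Type
  /-- the underlying set is finite -/
  finite : Finite carrier
  /-- the first order -/
  le₁ : carrier → carrier → Prop
  /-- the second order -/
  le₂ : carrier → carrier → Prop
  isPartialOrder₁ : IsPartialOrder carrier le₁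
  isPartialOrder₂ : IsPartialOrder carrier le₂

namespace DoublePoset

/-- Isomorphisms of double posets: bijections that preserve and reflect both orders. -/
structure Iso (P Q : DoublePoset) where
  toEquiv : P.carrier ≃ Q.carrier
  le₁_iff : ∀ x y, Q.le₁ (toEquiv x) (toEquiv y) ↔ P.le₁ x y
  le₂_iff : ∀ x y, Q.le₂ (toEquiv x) (toEquiv y) ↔ P.le₂ x y

/-- Being isomorphic is an equivalence relation on double posets. -/
instance isoSetoid : Setoid DoublePoset where
  r P Q := Nonempty (Iso P Q)
  iseqv :=
    { refl := fun P => ⟨⟨Equiv.refl _, fun _ _ => Iff.rfl, fun _ _ => Iff.rfl⟩⟩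
      symm := by
        rintro P Q ⟨e⟩
        refine ⟨⟨e.toEquiv.symm, fun x y => ?_, fun x y => ?_⟩⟩
        · rw [← e.le₁_iff]; simp
        · rw [← e.le₂_iff]; simp
      trans := by
        rintro P Q R ⟨e⟩ ⟨f⟩
        refine ⟨⟨e.toEquiv.trans f.toEquiv, fun x y => ?_, fun x y => ?_⟩⟩
        · simp [f.le₁_iff, e.le₁_iff]
        · simp [f.le₂_iff, e.le₂_iff] }

/-- A double poset `(P, ≤_h, ≤_r)` is plane if two distinct elements are comparable for `≤_h`
if and only if they are not comparable for `≤_r`. -/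
def IsPlane (P : DoublePoset) : Prop :=
  ∀ x y : P.carrier, x ≠ y →
    ((P.le₁ x y ∨ P.le₁ y x) ↔ ¬ (P.le₂ x y ∨ P.le₂ y x))

/-- `Covers₁ P x y`: there is an edge from `x` to `y` in the Hasse graph of `≤₁`, with edges
oriented upwards. -/
def Covers₁ (P : DoublePoset) (x y : P.carrier) : Prop :=
  P.le₁ x y ∧ x ≠ y ∧ ∀ z, P.le₁ x z → P.le₁ z y → z = x ∨ z = y

/-- A plane forest: a plane poset whose Hasse graph for `≤_h`, oriented from the roots (the minimal
elements) to the leaves, is a rooted forest, i.e. every vertex has at most one incoming edge. -/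
def IsPlaneForest (P : DoublePoset) : Prop :=
  P.IsPlane ∧ ∀ x y z : P.carrier, P.Covers₁ x z → P.Covers₁ y z → x = y

/-- A plane poset `(P, ≤_h, ≤_r)` seen as a special poset `(P, ≤_h, ≤)`, where `x ≤ y` if and only
if `x ≤_h y` or `x ≤_r y`. -/
def toSpecial (P : DoublePoset) (hP : P.IsPlane) : DoublePoset where
  carrier := P.carrier
  finite := P.finite
  le₁ := P.le₁
  le₂ x y := P.le₁ x y ∨ P.le₂ x y
  isPartialOrder₁ := P.isPartialOrder₁
  isPartialOrder₂ := by
    have h₁ := P.isPartialOrder₁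
    have h₂ := P.isPartialOrder₂
    have r₁ : ∀ x, P.le₁ x x := h₁.refl
    have t₁ : ∀ x y z, P.le₁ x y → P.le₁ y z → P.le₁ x z := h₁.trans
    have t₂ : ∀ x y z, P.le₂ x y → P.le₂ y z → P.le₂ x z := h₂.trans
    have a₁ : ∀ x y, P.le₁ x y → P.le₁ y x → x = y := h₁.antisymm
    have a₂ : ∀ x y, P.le₂ x y → P.le₂ y x → x = y := h₂.antisymm
    exact
      { refl := fun x => Or.inl (r₁ x)
        trans := fun x y z hxy hyz => by
          by_cases e₁ : x = y
          · subst e₁; exact hyz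
          by_cases e₂ : y = z
          · subst e₂; exact hxy
          by_cases e₃ : x = z
          · subst e₃; exact Or.inl (r₁ x)
          have p := hP x y e₁
          have q := hP y z e₂
          have r : (P.le₁ x z ∨ P.le₂ x z) ∨ (P.le₁ z x ∨ P.le₂ z x) := by
            have r := hP x z e₃
            clear p q hxy hyz
            tauto
          rcases r with r | r
          · exact r
          exfalso
          rcases hxy with h | h <;> rcases hyz with h' | h' <;> rcases r with r | r
          · exact e₁ (a₁ _ _ h (t₁ _ _ _ h' r))
          · exact (hP x z e₃).mp (Or.inl (t₁ _ _ _ h h')) (Or.inr r)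
          · exact q.mp (Or.inr (t₁ _ _ _ r h)) (Or.inl h')
          · exact p.mp (Or.inl h) (Or.inr (t₂ _ _ _ h' r))
          · exact p.mp (Or.inr (t₁ _ _ _ h' r)) (Or.inl h)
          · exact q.mp (Or.inl h') (Or.inr (t₂ _ _ _ r h))
          · exact (hP x z e₃).mp (Or.inr r) (Or.inl (t₂ _ _ _ h h'))
          · exact e₁ (a₂ _ _ h (t₂ _ _ _ h' r))
        antisymm := fun x y hxy hyx => by
          have p := hP x y
          grind }

/-- The induced order is total, so that `P.toSpecial hP` is indeed a special poset. -/
theorem toSpecial_total (P : DoublePoset) (hP : P.IsPlane) (x y : P.carrier) :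
    (P.toSpecial hP).le₂ x y ∨ (P.toSpecial hP).le₂ y x := by
  have h := hP x y
  have r := P.isPartialOrder₁.refl x
  change (P.le₁ x y ∨ P.le₂ x y) ∨ (P.le₁ y x ∨ P.le₂ y x)
  by_cases hxy : x = y
  · subst hxy
    exact Or.inl (Or.inl r)
  · tauto

/-- Pictures between two double posets `P` and `Q`: the bijections `σ : P → Q` such that
`i ≤₁ j` implies `σ i ≤₂ σ j`, and `σ i ≤₁ σ j` implies `i ≤₂ j`. -/
def pictures (P Q : DoublePoset) : Set (P.carrier ≃ Q.carrier) :=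
  {σ | (∀ i j, P.le₁ i j → Q.le₂ (σ i) (σ j)) ∧ (∀ i j, Q.le₁ (σ i) (σ j) → P.le₂ i j)}

/-- The number of pictures only depends on the isomorphism classes. -/
theorem card_pictures_congr {P P' Q Q' : DoublePoset} (e : Iso P P') (f : Iso Q Q') :
    Nat.card (pictures P Q) = Nat.card (pictures P' Q') := by
  refine Nat.card_congr (Equiv.subtypeEquiv (e.toEquiv.equivCongr f.toEquiv) fun σ => ?_)
  have key : ∀ x : P.carrier, (e.toEquiv.equivCongr f.toEquiv) σ (e.toEquiv x)
      = f.toEquiv (σ x) := by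
    intro x; simp [Equiv.equivCongr]
  simp only [pictures, Set.mem_ofPred_eq, e.toEquiv.forall_congr_right.symm, key, e.le₁_iff,
    e.le₂_iff, f.le₁_iff, f.le₂_iff]

end DoublePoset

/-- The set of isomorphism classes of double posets. -/
def DP : Type 1 := Quotient DoublePoset.isoSetoid

namespace DP

/-- The number of pictures between two isomorphism classes of double posets. -/
noncomputable def numPictures : DP → DP → ℕ :=
  Quotient.lift₂ (fun P Q => Nat.card (DoublePoset.pictures P Q)) (by
    rintro P Q P' Q' ⟨e⟩ ⟨f⟩
    exact DoublePoset.card_pictures_congr e f)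

/-- The set of plane forests, seen as special posets (up to isomorphism). -/
def SPF : Set DP :=
  {p | ∃ (P : DoublePoset) (hP : P.IsPlaneForest), p = Quotient.mk _ (P.toSpecial hP.1)}

/-- The vector space generated by (that is, with basis) the set of isomorphism classes of double
posets. -/
noncomputable abbrev Space (K : Type*) [Field K] : Type _ := DP →₀ K

/-- The pairing on the space generated by double posets: the bilinear form such that
`⟨P, Q⟩` is the number of pictures between `P` and `Q`, for all double posets `P` and `Q`. -/
noncomputable def pairing (K : Type*) [Field K] : LinearMap.BilinForm K (Space K) :=
  Finsupp.linearCombination K fun p : DP =>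
    Finsupp.linearCombination K fun q : DP => (numPictures p q : K)

/-- The pairing has the prescribed values on the basis of double posets. -/
theorem pairing_single (K : Type*) [Field K] (p q : DP) :
    pairing K (Finsupp.single p 1) (Finsupp.single q 1) = (numPictures p q : K) := by
  simp [pairing]

/-- The subspace generated by the plane forests, seen as special posets. -/
noncomputable def spfSubspace (K : Type*) [Field K] : Submodule K (Space K) :=
  Submodule.span K ((fun p : DP => Finsupp.single p (1 : K)) '' SPF)

end DP

open Equiv

/-! Numbering vertices along the total order turns a plane forest on `n` vertices into a
`ForestOrder n`, and a picture from `P` to `Q` into a permutation `σ` that is increasing along `P`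
and whose inverse is increasing along `Q`. Since `ofPerm σ` is the largest forest along which `σ`
increases, this reads `P ≤ ofPerm σ` and `Q ≤ ofPerm σ⁻¹`. The Gram matrix therefore factors as a
zeta matrix, times `M`, times a transposed zeta matrix, where `M A B` counts the `σ` with `ofPerm σ
= A` and `ofPerm σ⁻¹ = B`. Zeta matrices are unitriangular, so only `M` matters.

Each forest is `ofPerm u` for some `u` avoiding 213, and avoidance is stable under inversion. With
rows labelled by `ofPerm u` and columns by `ofPerm u⁻¹`, `M` is unitriangular for the lexicographic
order. Indeed, if `σ ≠ u` lies in the fibre of `ofPerm u`, then at the first difference `i` one has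
`σ i < u i`, and no 213 in `σ` starts before `i` (`exists_lt_of_ofPerm_eq`). The avoiding
permutation labelling the column of `σ` agrees with `σ` up to and including `i`
(`apply_eq_apply_of_avoidsAt`), so it precedes `u`. The diagonal entries are 1, hence the
characteristic of `K` plays no role. -/

/-- A total order on a finite set is isomorphic to the usual order on an initial segment. -/
theorem exists_equiv_fin_le_iff {α : Type*} [Finite α] {n : ℕ} (hn : Nat.card α = n)
    (r : α → α → Prop) (refl : ∀ x, r x x) (trans : ∀ x y z, r x y → r y z → r x z)
    (antisymm : ∀ x y, r x y → r y x → x = y) (total : ∀ x y, r x y ∨ r y x) :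
    ∃ e : α ≃ Fin n, ∀ x y, e x ≤ e y ↔ r x y := by
  classical
  let _ : Fintype α := Fintype.ofFinite α
  let _ : LinearOrder α :=
    { le := r
      le_refl := refl
      le_trans := trans
      le_antisymm := antisymm
      le_total := total
      toDecidableLE := Classical.decRel r }
  let e := Fintype.orderIsoFinOfCardEq α (k := n) (by rw [← hn, Nat.card_eq_fintype_card])
  exact ⟨e.symm.toEquiv, fun x y => e.symm.le_iff_le⟩

/-- A function on a finite poset with vanishing sums over all principal upper sets is zero. -/
theorem eq_zero_of_sum_Ici_eq_zero {α K : Type*} [Fintype α] [PartialOrder α] [AddCommMonoid K]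
    [DecidableLE α] (φ : α → K) (h : ∀ a, ∑ b with a ≤ b, φ b = 0) (a : α) : φ a = 0 := by
  induction a using (wellFounded_gt (α := α)).induction with
  | _ a ih =>
    rw [← h a]
    refine (Finset.sum_eq_single_of_mem a (by simp) fun b hb hba => ih b ?_).symm
    exact lt_of_le_of_ne (Finset.mem_filter.1 hb).2 hba.symm

/-! ### Forest orders and permutations -/

/-- A plane forest with vertices `0, …, n - 1` in depth-first order, given by its ancestor
relation: the descendants of each vertex form an interval. -/
@[ext]
structure ForestOrder (n : ℕ) where
  rel : Fin n → Fin n → Prop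
  refl : ∀ x, rel x x
  trans : ∀ x y z, rel x y → rel y z → rel x z
  le_of_rel : ∀ x y, rel x y → x ≤ y
  interval : ∀ x y z, rel x z → x ≤ y → y ≤ z → rel x y

namespace ForestOrder

variable {n : ℕ}

theorem rel_injective : Function.Injective (rel : ForestOrder n → _) := fun _ _ => ForestOrder.ext

instance : PartialOrder (ForestOrder n) := PartialOrder.lift rel rel_injective

instance : Finite (ForestOrder n) := Finite.of_injective rel rel_injective

noncomputable instance : Fintype (ForestOrder n) := Fintype.ofFinite _

/-- The largest forest order for which `σ` is increasing. -/
def ofPerm (σ : Perm (Fin n)) : ForestOrder n where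
  rel x y := x ≤ y ∧ ∀ z, x ≤ z → z ≤ y → σ x ≤ σ z
  refl x := ⟨le_rfl, fun z h h' => (congrArg σ (le_antisymm h h')).le⟩
  trans x y z h h' := ⟨h.1.trans h'.1, fun w hx hz => by
    rcases le_total w y with hw | hw
    · exact h.2 w hx hw
    · exact (h.2 y h.1 le_rfl).trans (h'.2 w hw hz)⟩
  le_of_rel _ _ h := h.1
  interval x y z h hx hz := ⟨hx, fun w h₁ h₂ => h.2 w h₁ (h₂.trans hz)⟩

theorem le_ofPerm_iff {P : ForestOrder n} {σ : Perm (Fin n)} :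
    P ≤ ofPerm σ ↔ ∀ x y, P.rel x y → σ x ≤ σ y :=
  ⟨fun h x y hxy => (h x y hxy).2 y (P.le_of_rel x y hxy) le_rfl, fun h x y hxy =>
    ⟨P.le_of_rel x y hxy, fun z hx hy => h x z (P.interval x z y hxy hx hy)⟩⟩

/-! ### Permutations avoiding 213 -/

/-- The position `x` does not play the role of the letter `2` in an occurrence of the pattern
`213` in `σ`. -/
def AvoidsAt (σ : Perm (Fin n)) (x : Fin n) : Prop :=
  ∀ y z, x < y → y < z → σ y < σ x → ¬ σ x < σ z

/-- The permutation `σ` avoids the pattern `213`. -/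
def Avoids (σ : Perm (Fin n)) : Prop := ∀ x, AvoidsAt σ x

/-- The pattern 213 is an involution, so inversion carries its occurrences to occurrences. -/
theorem Avoids.inv {σ : Perm (Fin n)} (h : Avoids σ) : Avoids σ⁻¹ := fun x y z hxy hyz h₁ h₂ =>
  h _ _ _ h₁ h₂ (by simpa using hxy) (by simpa using hyz)

/-- Every forest order comes from a permutation avoiding `213`. -/
theorem exists_avoids_ofPerm_eq (P : ForestOrder n) : ∃ σ, Avoids σ ∧ ofPerm σ = P := by
  -- `σ` ranks the vertices by the traversal from right to left: ancestors still come first, but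
  -- incomparable vertices appear in reverse order.
  obtain ⟨σ, hσ⟩ := exists_equiv_fin_le_iff (n := n) (by simp)
    (fun x y => P.rel x y ∨ y < x ∧ ¬ P.rel y x) (fun x => Or.inl (P.refl x))
    (by
      rintro x y z (h₁ | ⟨h₁, h₁'⟩) (h₂ | ⟨h₂, h₂'⟩)
      · exact Or.inl (P.trans x y z h₁ h₂)
      · rcases le_or_gt x z with h | h
        · exact Or.inl (P.interval x z y h₁ h h₂.le)
        · exact Or.inr ⟨h, fun h' => h₂' (P.trans z x y h' h₁)⟩
      · rcases le_or_gt x z with h | h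
        · exact absurd (P.interval y x z h₂ h₁.le h) h₁'
        · exact Or.inr ⟨h, fun h' => h₁' (P.trans y z x h₂ h')⟩
      · exact Or.inr ⟨h₂.trans h₁, fun h => h₂' (P.interval z y x h h₂.le h₁.le)⟩)
    (by
      rintro x y (h₁ | ⟨h₁, h₁'⟩) (h₂ | ⟨h₂, h₂'⟩)
      · exact le_antisymm (P.le_of_rel x y h₁) (P.le_of_rel y x h₂)
      · exact absurd h₁ h₂'
      · exact absurd h₂ h₁'
      · exact absurd h₁ h₂.asymm)
    (by
      intro x y
      have := P.refl x
      rcases lt_trichotomy x y with h | rfl | h <;> tauto)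
  refine ⟨σ, fun x y z hxy hyz h₁ h₂ => ?_, ?_⟩
  · rw [← not_le, hσ] at h₁
    rcases (hσ x z).1 h₂.le with h | ⟨h, -⟩
    · exact h₁ (Or.inl (P.interval x y z h hxy.le hyz.le))
    · exact absurd h (hxy.trans hyz).asymm
  · refine le_antisymm (fun x y h => ?_) (le_ofPerm_iff.2 fun x y h => (hσ x y).2 (Or.inl h))
    rcases (hσ x y).1 (h.2 y h.1 le_rfl) with h' | ⟨h', -⟩
    · exact h'
    · exact absurd h' h.1.not_gt

/-! ### Lexicographic comparison of permutations -/

/-- If `σ` and `u` take the same values before `i`, then every value which `u` takes from `i` on,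
other than `σ i`, is taken by `σ` to the right of `i`. -/
theorem lt_symm_apply_of_eqOn_Iio {σ u : Perm (Fin n)} {i : Fin n} (h : ∀ j < i, σ j = u j) {v : Fin n}
    (hv : i ≤ u.symm v) (hne : v ≠ σ i) : i < σ.symm v := by
  rcases lt_trichotomy (σ.symm v) i with hlt | heq | hgt
  · have h' := h _ hlt
    rw [σ.apply_symm_apply] at h'
    rw [h', u.symm_apply_apply] at hv
    exact absurd hv hlt.not_ge
  · exact absurd (by rw [← heq, σ.apply_symm_apply]) hne
  · exact hgt

theorem rel_ofPerm_of_avoidsAt {u : Perm (Fin n)} {i y : Fin n} (hu : AvoidsAt u i) (hiy : i < y)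
    (hlt : u i < u y) : (ofPerm u).rel i y := by
  refine ⟨hiy.le, fun z hz hzy => ?_⟩
  by_contra! hlt'
  rcases hz.eq_or_lt with rfl | hz
  · exact hlt'.false
  rcases hzy.eq_or_lt with rfl | hzy
  · exact hlt.asymm hlt'
  · exact hu z y hz hzy hlt' hlt

theorem not_rel_ofPerm {u : Perm (Fin n)} {i y : Fin n} (hiy : i < y)
    (hlt : u y < u i) : ¬ (ofPerm u).rel i y := fun h => (h.2 y hiy.le le_rfl).not_gt hlt

theorem apply_lt_of_not_rel {u : Perm (Fin n)} {i y : Fin n} (hu : AvoidsAt u i) (hiy : i < y)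
    (h : ¬ (ofPerm u).rel i y) : u y < u i :=
  lt_of_le_of_ne (not_lt.1 fun hlt => h (rel_ofPerm_of_avoidsAt hu hiy hlt))
    (u.injective.ne hiy.ne')

/-- Assume that `σ` and `u` have the same forest order and the same values before `i`, with `u`
avoiding `213`, and that `u i ≤ σ i`. Then the positions to the right of `i` outside of the
descendants of `i` are permuted by `σ.symm ∘ u`. -/
theorem surjOn_symm_comp {σ u : Perm (Fin n)} {i : Fin n} (hu : AvoidsAt u i)
    (hσu : ofPerm σ = ofPerm u) (h : ∀ j < i, σ j = u j) (hi : u i ≤ σ i) :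
    Set.SurjOn (fun x => σ.symm (u x)) {x | i < x ∧ ¬ (ofPerm u).rel i x}
      {x | i < x ∧ ¬ (ofPerm u).rel i x} := by
  refine (((Set.toFinite _).injOn_iff_bijOn_of_mapsTo ?_).1
    (σ.symm.injective.comp u.injective).injOn).surjOn
  rintro x ⟨hix, hx⟩
  have hlt : u x < u i := apply_lt_of_not_rel hu hix hx
  refine ⟨lt_symm_apply_of_eqOn_Iio h (by simpa using hix.le) (hlt.trans_le hi).ne, ?_⟩
  rw [← hσu]
  refine not_rel_ofPerm (lt_symm_apply_of_eqOn_Iio h (by simpa using hix.le) (hlt.trans_le hi).ne) ?_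
  simpa using hlt.trans_le hi

/-- If `u` avoids `213` and has the same forest order as `σ ≠ u`, then `σ` is lexicographically
smaller than `u`, and the first occurrence of `213` in `σ` is not before the first difference. -/
theorem exists_lt_of_ofPerm_eq {σ u : Perm (Fin n)} (hu : Avoids u) (hσu : ofPerm σ = ofPerm u)
    (hne : σ ≠ u) :
    ∃ i, (∀ j < i, σ j = u j) ∧ (∀ j < i, AvoidsAt σ j) ∧ σ i < u i := by
  have hex : ∃ i, σ i ≠ u i := by
    by_contra! h
    exact hne (Equiv.ext h)
  obtain ⟨i, hi, hmin⟩ := (wellFounded_lt (α := Fin n)).has_min {i | σ i ≠ u i} hex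
  have h : ∀ j < i, σ j = u j := fun j hj => by
    by_contra hne
    exact hmin j hne hj
  refine ⟨i, h, fun j hj y z hjy hyz h₁ h₂ => ?_, ?_⟩
  · have hz : ¬ (ofPerm u).rel j z := fun hr =>
      not_rel_ofPerm hjy h₁ (hσu ▸ (ofPerm u).interval j y z hr hjy.le hyz.le)
    obtain ⟨x, ⟨hjx, hx⟩, hxz⟩ := surjOn_symm_comp (hu j) hσu (fun k hk => h k (hk.trans hj))
      (h j hj).ge ⟨hjy.trans hyz, hz⟩
    have hlt := apply_lt_of_not_rel (hu j) hjx hx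
    rw [Equiv.symm_apply_eq] at hxz
    rw [hxz, ← h j hj] at hlt
    exact hlt.asymm h₂
  · by_contra! hle
    have hp : i < σ.symm (u i) := lt_symm_apply_of_eqOn_Iio h (by simp) (Ne.symm hi)
    have hr : ¬ (ofPerm u).rel i (σ.symm (u i)) := by
      rw [← hσu]
      exact not_rel_ofPerm hp (by simpa using lt_of_le_of_ne hle (Ne.symm hi))
    obtain ⟨x, ⟨hix, -⟩, hx⟩ := surjOn_symm_comp (hu i) hσu h hle ⟨hp, hr⟩
    exact hix.ne' (u.injective (σ.symm.injective hx))

/-- If `σ` and `τ` avoid `213` before position `k`, have the same values before `k`, and if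
their inverses have the same forest order, then they agree at `k`. -/
theorem apply_le_apply_of_avoidsAt {σ τ : Perm (Fin n)} (hστ : ofPerm σ⁻¹ = ofPerm τ⁻¹) {k : Fin n}
    (h : ∀ j < k, σ j = τ j) (hσ : ∀ j < k, AvoidsAt σ j) : τ k ≤ σ k := by
  by_contra! hlt
  have hw : k < σ.symm (τ k) :=
    lt_symm_apply_of_eqOn_Iio h (by simp) hlt.ne'
  have hv : k < τ.symm (σ k) :=
    lt_symm_apply_of_eqOn_Iio (fun j hj => (h j hj).symm) (by simp) hlt.ne
  have hrel : ¬ (ofPerm σ⁻¹).rel (σ k) (τ k) := by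
    rw [hστ]
    exact not_rel_ofPerm hlt (by simpa using hv)
  refine hrel ⟨hlt.le, fun w hw₁ hw₂ => ?_⟩
  by_contra! hlt'
  have hlt' : σ.symm w < k := by simpa using hlt'
  have hw₁ : σ k < w := lt_of_le_of_ne hw₁ (by rintro rfl; exact hlt'.ne (σ.symm_apply_apply k))
  have hw₂ : w < τ k := lt_of_le_of_ne hw₂ (by rintro rfl; exact hw.asymm hlt')
  exact hσ _ hlt' k _ hlt' hw (by simpa using hw₁) (by simpa using hw₂)

theorem apply_eq_apply_of_avoidsAt {σ τ : Perm (Fin n)} (hστ : ofPerm σ⁻¹ = ofPerm τ⁻¹) {i : Fin n}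
    (hσ : ∀ j < i, AvoidsAt σ j) (hτ : Avoids τ) (k : Fin n) (hk : k ≤ i) : σ k = τ k := by
  induction k using (wellFounded_lt (α := Fin n)).induction with
  | _ k ih =>
    have h : ∀ j < k, σ j = τ j := fun j hj => ih j hj (hj.le.trans hk)
    exact le_antisymm
      (apply_le_apply_of_avoidsAt hστ.symm (fun j hj => (h j hj).symm) fun j _ => hτ j)
      (apply_le_apply_of_avoidsAt hστ h fun j hj => hσ j (hj.trans_le hk))

open Classical in
/-- The number of permutations `σ` with given forest orders for `σ` and `σ⁻¹` defines an invertible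
matrix. -/
theorem eq_zero_of_sum_ofPerm_eq {K : Type*} [AddCommMonoid K] (F : ForestOrder n → K)
    (h : ∀ P : ForestOrder n, ∑ σ : Perm (Fin n) with ofPerm σ = P, F (ofPerm σ⁻¹) = 0)
    (P : ForestOrder n) : F P = 0 := by
  have key : ∀ w : Lex (Fin n → Fin n), ∀ u : Perm (Fin n), toLex ⇑u = w → Avoids u →
      F (ofPerm u⁻¹) = 0 := by
    intro w
    induction w using (wellFounded_lt (α := Lex (Fin n → Fin n))).induction with
    | _ w ih =>
      rintro u rfl hu
      refine (Finset.sum_eq_single_of_mem (f := fun σ : Perm (Fin n) => F (ofPerm σ⁻¹)) u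
        (Finset.mem_filter (p := fun σ => ofPerm σ = ofPerm u).2 ⟨Finset.mem_univ u, rfl⟩) fun σ hσ hne => ?_).symm.trans
        (h (ofPerm u))
      obtain ⟨i, hi, hav, hlt⟩ := exists_lt_of_ofPerm_eq hu (Finset.mem_filter.1 hσ).2 hne
      obtain ⟨τ, hτ, hτσ⟩ := exists_avoids_ofPerm_eq (ofPerm σ⁻¹)
      have heq := apply_eq_apply_of_avoidsAt (τ := τ⁻¹) (by rw [inv_inv, hτσ]) hav hτ.inv
      have := ih (toLex ⇑τ⁻¹) ⟨i, fun j hj => (heq j hj.le).symm.trans (hi j hj),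
        (heq i le_rfl).symm.trans_lt hlt⟩ τ⁻¹ rfl hτ.inv
      rwa [inv_inv, hτσ] at this
  obtain ⟨τ, hτ, rfl⟩ := exists_avoids_ofPerm_eq P
  simpa using key _ τ⁻¹ rfl hτ.inv

open Classical in
/-- The matrix of the pairing between forest orders has trivial kernel. -/
theorem eq_zero_of_sum_card_eq_zero {K : Type*} [CommRing K] (g : ForestOrder n → K)
    (h : ∀ Q : ForestOrder n, ∑ P, g P *
      ((Finset.univ.filter fun σ : Perm (Fin n) => P ≤ ofPerm σ ∧ Q ≤ ofPerm σ⁻¹).card : K) = 0)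
    (P : ForestOrder n) : g P = 0 := by
  refine eq_zero_of_sum_Ici_eq_zero (α := (ForestOrder n)ᵒᵈ) (fun P => g (OrderDual.ofDual P))
    (fun A => ?_) (OrderDual.toDual P)
  refine eq_zero_of_sum_ofPerm_eq (fun A => ∑ P with P ≤ A, g P) (fun Q => ?_) A
  refine eq_zero_of_sum_Ici_eq_zero
    (fun Q => ∑ σ : Perm (Fin n) with ofPerm σ = Q, ∑ P with P ≤ ofPerm σ⁻¹, g P) (fun Q => ?_) Q
  rw [← h Q]
  calc ∑ B with Q ≤ B, ∑ σ : Perm (Fin n) with ofPerm σ = B, ∑ P with P ≤ ofPerm σ⁻¹, g P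
      = ∑ σ : Perm (Fin n) with Q ≤ ofPerm σ, ∑ P with P ≤ ofPerm σ⁻¹, g P := by
        rw [← Finset.sum_fiberwise_of_maps_to (s := Finset.univ.filter fun σ => Q ≤ ofPerm σ)
          (t := Finset.univ.filter fun B => Q ≤ B) (g := ofPerm) (by simp)]
        refine Finset.sum_congr rfl fun B hB => Finset.sum_congr ?_ fun _ _ => rfl
        ext σ
        simp only [Finset.mem_filter, Finset.mem_univ, true_and] at hB ⊢
        exact ⟨fun h => ⟨h ▸ hB, h⟩, fun h => h.2⟩
    _ = ∑ σ : Perm (Fin n) with Q ≤ ofPerm σ⁻¹, ∑ P with P ≤ ofPerm σ, g P := by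
        refine Finset.sum_equiv (Equiv.inv _) (by simp) (by simp)
    _ = _ := by
        rw [Finset.sum_comm' (t' := Finset.univ)
          (s' := fun P => Finset.univ.filter fun σ => P ≤ ofPerm σ ∧ Q ≤ ofPerm σ⁻¹)
          (by simp [and_comm])]
        simp [mul_comm]

/-- The double poset attached to a forest order. -/
def toDoublePoset (P : ForestOrder n) : DoublePoset where
  carrier := Fin n
  finite := inferInstance
  le₁ := P.rel
  le₂ x y := x ≤ y
  isPartialOrder₁ :=
    { refl := P.refl
      trans := P.trans
      antisymm := fun x y h h' => le_antisymm (P.le_of_rel x y h) (P.le_of_rel y x h') }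
  isPartialOrder₂ := inferInstance

/-- The isomorphism class of the double poset attached to a forest order. -/
def toDP (P : ForestOrder n) : DP := Quotient.mk _ P.toDoublePoset

theorem toDP_injective : Function.Injective (toDP : ForestOrder n → DP) := by
  intro P Q h
  obtain ⟨e⟩ := Quotient.exact h
  let f : Fin n ≃o Fin n := ⟨e.toEquiv, fun {x y} => e.le₂_iff x y⟩
  have hf : ∀ x, e.toEquiv x = x := fun x =>
    congrArg (fun g : Fin n ≃o Fin n => g x) (Subsingleton.elim f (OrderIso.refl _))
  ext x y
  have h : Q.rel (e.toEquiv x) (e.toEquiv y) ↔ P.rel x y := e.le₁_iff x y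
  exact (h.symm.trans (iff_of_eq (congrArg₂ Q.rel (hf x) (hf y))))

open Classical in
theorem numPictures_toDP (P Q : ForestOrder n) : DP.numPictures P.toDP Q.toDP =
    (Finset.univ.filter fun σ : Perm (Fin n) => P ≤ ofPerm σ ∧ Q ≤ ofPerm σ⁻¹).card := by
  change Nat.card (DoublePoset.pictures _ _) = _
  rw [← Fintype.card_subtype, ← Nat.card_eq_fintype_card]
  refine Nat.card_congr (Equiv.subtypeEquivRight fun σ : Perm (Fin n) => ?_)
  refine and_congr le_ofPerm_iff.symm (Iff.trans ?_ le_ofPerm_iff.symm)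
  refine ⟨fun h x y hxy => h _ _ ?_, fun h (x : Fin n) (y : Fin n) hxy => ?_⟩
  · have hx := σ.apply_symm_apply x
    have hy := σ.apply_symm_apply y
    change Q.rel (σ (σ.symm x)) (σ (σ.symm y))
    rwa [hx, hy]
  · have := h _ _ hxy
    change σ.symm (σ x) ≤ σ.symm (σ y) at this
    rwa [σ.symm_apply_apply, σ.symm_apply_apply] at this

theorem numPictures_toDP_of_ne {m : ℕ} (P : ForestOrder m) (Q : ForestOrder n) (h : m ≠ n) :
    DP.numPictures P.toDP Q.toDP = 0 := by
  change Nat.card (DoublePoset.pictures _ _) = _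
  have : IsEmpty (DoublePoset.pictures P.toDoublePoset Q.toDoublePoset) :=
    ⟨fun σ => h (Fin.equiv_iff_eq.1 ⟨σ.1⟩)⟩
  exact Nat.card_of_isEmpty

theorem toDP_mem_SPF (P : ForestOrder n) : P.toDP ∈ DP.SPF := by
  have hr : ∀ x y, P.rel x y → x ≤ y := P.le_of_rel
  let R : DoublePoset :=
    { carrier := Fin n
      finite := inferInstance
      le₁ := P.rel
      le₂ := fun x y => x = y ∨ x < y ∧ ¬ P.rel x y
      isPartialOrder₁ := P.toDoublePoset.isPartialOrder₁
      isPartialOrder₂ :=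
        { refl := fun x => Or.inl rfl
          trans := by
            rintro x y z (rfl | ⟨h, h'⟩) (rfl | ⟨k, k'⟩)
            · exact Or.inl rfl
            · exact Or.inr ⟨k, k'⟩
            · exact Or.inr ⟨h, h'⟩
            · exact Or.inr ⟨h.trans k, fun hr => h' (P.interval x y z hr h.le k.le)⟩
          antisymm := by
            rintro x y (rfl | ⟨h, h'⟩) (h₁ | ⟨k, k'⟩)
            · rfl
            · rfl
            · exact h₁.symm
            · exact absurd h k.asymm } }
  have hplane : R.IsPlane := by
    intro x y hxy
    change (P.rel x y ∨ P.rel y x) ↔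
      ¬ ((x = y ∨ x < y ∧ ¬ P.rel x y) ∨ (y = x ∨ y < x ∧ ¬ P.rel y x))
    have h₁ := hr x y
    have h₂ := hr y x
    rcases lt_or_gt_of_ne hxy with h | h
    · have := mt h₂ h.not_ge
      have := h.asymm
      have := hxy.symm
      tauto
    · have := mt h₁ h.not_ge
      have := h.asymm
      have := hxy.symm
      tauto
  have aux : ∀ x y z : Fin n, R.Covers₁ x z → R.Covers₁ y z → x ≤ y → x = y := by
    rintro x y z ⟨h₁, -, h₃⟩ ⟨k₁, k₂, -⟩ hxy
    rcases h₃ y (P.interval x y z h₁ hxy (hr y z k₁)) k₁ with h | h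
    · exact h.symm
    · exact absurd h k₂
  refine ⟨R, ⟨hplane, fun x y z h k => ?_⟩, Quotient.sound ⟨⟨Equiv.refl _, fun _ _ => Iff.rfl, ?_⟩⟩⟩
  · rcases le_total (α := Fin n) x y with hxy | hxy
    · exact aux x y z h k hxy
    · exact (aux y x z k h hxy).symm
  · intro (x : Fin n) (y : Fin n)
    change (P.rel x y ∨ (x = y ∨ x < y ∧ ¬ P.rel x y)) ↔ x ≤ y
    have h₁ := hr x y
    have := P.refl x
    rw [le_iff_eq_or_lt] at h₁ ⊢
    tauto

end ForestOrder

/-- In a plane forest, two elements below a third one are comparable. -/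
theorem DoublePoset.IsPlaneForest.comparable {P : DoublePoset} (hP : P.IsPlaneForest)
    (z : P.carrier) : ∀ x y, P.le₁ x z → P.le₁ y z → P.le₁ x y ∨ P.le₁ y x := by
  have _ := P.finite
  let _ : PartialOrder P.carrier :=
    { le := P.le₁
      le_refl := P.isPartialOrder₁.refl
      le_trans := P.isPartialOrder₁.trans
      le_antisymm := P.isPartialOrder₁.antisymm }
  have hcov : ∀ x z : P.carrier, x ⋖ z → P.Covers₁ x z := fun x z h =>
    ⟨h.le, h.ne, fun w h₁ h₂ => h.eq_or_eq h₁ h₂⟩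
  change ∀ x y, x ≤ z → y ≤ z → x ≤ y ∨ y ≤ x
  induction z using (wellFounded_lt (α := P.carrier)).induction with
  | _ z ih =>
    intro x y hx hy
    rcases hx.eq_or_lt with rfl | hx
    · exact Or.inr hy
    rcases hy.eq_or_lt with rfl | hy
    · exact Or.inl hx.le
    obtain ⟨x', hxx', hx'⟩ := exists_le_covBy_of_lt hx
    obtain ⟨y', hyy', hy'⟩ := exists_le_covBy_of_lt hy
    obtain rfl := hP.2 x' y' z (hcov _ _ hx') (hcov _ _ hy')
    exact ih x' hx'.lt x y hxx' hyy'

theorem DP.exists_toDP_eq {p : DP} (hp : p ∈ DP.SPF) :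
    ∃ (n : ℕ) (P : ForestOrder n), P.toDP = p := by
  obtain ⟨P, hP, rfl⟩ := hp
  have _ := P.finite
  have o := (P.toSpecial hP.1).isPartialOrder₂
  have o₁ := P.isPartialOrder₁
  have o₂ := P.isPartialOrder₂
  obtain ⟨e, he⟩ := exists_equiv_fin_le_iff (α := P.carrier) rfl (P.toSpecial hP.1).le₂ o.refl
    o.trans o.antisymm (P.toSpecial_total hP.1)
  have he' : ∀ x y, x ≤ y ↔ (P.toSpecial hP.1).le₂ (e.symm x) (e.symm y) := fun x y => by
    rw [← he, e.apply_symm_apply, e.apply_symm_apply]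
  have interval : ∀ x y z, P.le₁ x z → (P.toSpecial hP.1).le₂ x y → (P.toSpecial hP.1).le₂ y z →
      P.le₁ x y := by
    rintro x y z hxz (h | h) (k | k)
    · exact h
    · exact h
    · by_cases hxy : x = y
      · subst hxy; exact o₁.refl _
      · exact absurd (Or.inl h) ((hP.1 x y hxy).1 (hP.comparable z x y hxz k))
    · by_cases hxy : x = z
      · subst hxy
        rw [o₂.antisymm _ _ h k]
        exact o₁.refl _
      · exact absurd (Or.inl (o₂.trans _ _ _ h k)) ((hP.1 x z hxy).1 (Or.inl hxz))
  refine ⟨_, ⟨fun x y => P.le₁ (e.symm x) (e.symm y), fun x => o₁.refl _,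
    fun x y z => o₁.trans _ _ _, fun x y h => (he' x y).2 (Or.inl h),
    fun x y z h hx hz => interval _ _ _ h ((he' _ _).1 hx) ((he' _ _).1 hz)⟩, ?_⟩
  exact Quotient.sound ⟨⟨e.symm, fun x y => Iff.rfl, fun x y => (he' x y).symm⟩⟩

theorem DP.numPictures_comm (p q : DP) : DP.numPictures p q = DP.numPictures q p := by
  induction p using Quotient.inductionOn with | _ P =>
  induction q using Quotient.inductionOn with | _ Q =>
  refine Nat.card_congr (Equiv.subtypeEquiv ⟨Equiv.symm, Equiv.symm, fun _ => rfl, fun _ => rfl⟩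
    fun σ => ?_)
  constructor
  · rintro ⟨h₁, h₂⟩
    exact ⟨fun i j h => h₂ _ _ (by simpa using h), fun i j h => by simpa using h₁ _ _ h⟩
  · rintro ⟨h₁, h₂⟩
    exact ⟨fun i j h => h₂ _ _ (by simpa using h), fun i j h => by simpa using h₁ _ _ h⟩

theorem DP.pairing_apply_single (K : Type*) [Field K] (f : DP.Space K) (q : DP) :
    DP.pairing K f (Finsupp.single q 1) = f.sum fun p a => a * (DP.numPictures p q : K) := by
  simp [DP.pairing, Finsupp.linearCombination_apply, Finsupp.sum, LinearMap.sum_apply]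

theorem DP.pairing_isSymm (K : Type*) [Field K] (f g : DP.Space K) :
    DP.pairing K f g = DP.pairing K g f := by
  suffices h : DP.pairing K = (DP.pairing K).flip by
    conv_lhs => rw [h]
    rfl
  ext p q
  simp [DP.pairing, DP.numPictures_comm p q]

theorem DP.eq_zero_of_pairing_eq_zero (K : Type*) [Field K] (f : DP.Space K)
    (hf : f ∈ DP.spfSubspace K) (h : ∀ g ∈ DP.spfSubspace K, DP.pairing K f g = 0) : f = 0 := by
  classical
  rw [DP.spfSubspace, ← Finsupp.supported_eq_span_single, Finsupp.mem_supported] at hf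
  have key : ∀ (n : ℕ) (P : ForestOrder n), f P.toDP = 0 := by
    intro n
    refine ForestOrder.eq_zero_of_sum_card_eq_zero (fun P => f P.toDP) fun Q => ?_
    rw [← h _ (Submodule.subset_span ⟨_, Q.toDP_mem_SPF, rfl⟩), DP.pairing_apply_single]
    simp only [← ForestOrder.numPictures_toDP]
    rw [← Finset.sum_image (f := fun p => f p * (DP.numPictures p Q.toDP : K))
      ForestOrder.toDP_injective.injOn, Finsupp.sum]
    refine (Finset.sum_subset (Finset.subset_union_left (s₂ := f.support)) ?_).trans
      (Finset.sum_subset Finset.subset_union_right ?_).symm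
    rotate_left
    · intro p _ hp
      rw [Finsupp.notMem_support_iff.1 hp, zero_mul]
    · intro p hp hp'
      obtain ⟨m, P, rfl⟩ := DP.exists_toDP_eq
        (hf (Finset.mem_coe.2 ((Finset.mem_union.1 hp).resolve_left hp')))
      rw [ForestOrder.numPictures_toDP_of_ne, Nat.cast_zero, mul_zero]
      rintro rfl
      exact hp' (by simp)
  ext p
  by_cases hp : p ∈ f.support
  · obtain ⟨n, P, rfl⟩ := DP.exists_toDP_eq (hf hp)
    exact key n P
  · exact Finsupp.notMem_support_iff.1 hp

theorem corollary37 (K : Type*) [Field K] :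
    ((DP.pairing K).restrict (DP.spfSubspace K)).Nondegenerate := by
  have h₁ : ∀ f : DP.spfSubspace K, (∀ g : DP.spfSubspace K, DP.pairing K f g = 0) → f = 0 :=
    fun f h => Subtype.ext (DP.eq_zero_of_pairing_eq_zero K f f.2 fun g hg => h ⟨g, hg⟩)
  exact ⟨h₁, fun g h => h₁ g fun f => (DP.pairing_isSymm K _ _).trans (h f)⟩
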